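/- All groups are finite. Let $G$ be a solvable $A$-group (that is, all Sylow subgroups of $G$ are abelian) of derived length $2$ with $Z(G)=1$, and suppose that $G$ is neither a Frobenius group nor a 2-Frobenius group (a group $X$ is 2-Frobenius if it has normal subgroups $K\le H$ such that $H$ is a Frobenius group with kernel $K$ and $X/K$ is a Frobenius group with kernel $H/K$). Let $\Gamma(G)$ be the commuting graph of $G$: its vertices are the noncentral elements of $G$, and two distinct vertices are adjacent if and only if they commute. Then $\Gamma(G)$ is connected and has diameter at most $4$. More precisely, call a choice of one Sylow $p$-subgroup of $G$ for each prime $p$ dividing $|G|$, any two of which permute, a Sylow system, and call the subgroup $M$ of all elements of $G$ normalizing every member of a Sylow system an absolute system normalizer of $G$. Then $G$ has a Sylow system, and for every absolute system normalizer $M$ of $G$: 1. there is an element $x^*\in M$ with $x^*\ne 1$ and $C_{G'}(x^*)\neq 1$; 2. for every such $x^*$, the center of $\langle x^*\rangle G'$ is nontrivial, and for every element $c^*\neq 1$ of $Z(\langle x^*\rangle G')$, every vertex $g$ of $\Gamma(G)$ satisfies $d(g,c^*)\le 2$, where $d$ is the distance in $\Gamma(G)$. -/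

import Mathlib

open scoped Pointwise

/-- An `A`-group: all Sylow subgroups (for all primes) are abelian. -/
def IsAGroup (G : Type*) [Group G] : Prop :=
  ∀ p : ℕ, p.Prime → ∀ P : Sylow p G, IsMulCommutative (P : Subgroup G)

/-- `n` is the derived length of `G`: the least `n` with `G⁽ⁿ⁾ = 1`. -/
def HasDerivedLength (G : Type*) [Group G] (n : ℕ) : Prop :=
  IsLeast {k : ℕ | derivedSeries G k = ⊥} n

/-- The (finite) group `G` is a Frobenius group with kernel `N`: `N` is a nontrivial normal
subgroup having a nontrivial complement `A`, and no nontrivial element of `A` fixes, under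
conjugation, a nontrivial element of `N`. -/
def IsFrobeniusWithKernel (G : Type*) [Group G] (N : Subgroup G) : Prop :=
  N.Normal ∧ N ≠ ⊥ ∧ ∃ A : Subgroup G, A ≠ ⊥ ∧ Subgroup.IsComplement' N A ∧
    ∀ a ∈ A, a ≠ 1 → ∀ n ∈ N, a * n * a⁻¹ = n → n = 1

/-- `G` is a Frobenius group. -/
def IsFrobenius (G : Type*) [Group G] : Prop :=
  ∃ N : Subgroup G, IsFrobeniusWithKernel G N

/-- `G` is a 2-Frobenius group: there are normal subgroups `K ≤ H` of `G` such that `H` is a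
Frobenius group with kernel `K` and `G / K` is a Frobenius group with kernel `H / K`. -/
def IsTwoFrobenius (G : Type*) [Group G] : Prop :=
  ∃ (H K : Subgroup G) (_ : H.Normal) (_ : K.Normal), K ≤ H ∧
    IsFrobeniusWithKernel H (K.subgroupOf H) ∧
    IsFrobeniusWithKernel (G ⧸ K) (H.map (QuotientGroup.mk' K))

/-- The commuting graph: the vertices are the noncentral elements of `G`, and two distinct
vertices are adjacent if and only if they commute. -/
def commutingGraph (G : Type*) [Group G] : SimpleGraph {g : G // g ∉ Subgroup.center G} where
  Adj x y := x ≠ y ∧ Commute (x : G) (y : G)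
  symm := ⟨fun _ _ h => ⟨h.1.symm, h.2.symm⟩⟩
  loopless := ⟨fun _ h => h.1 rfl⟩

/-- A Sylow system of a finite group `G`: one Sylow `p`-subgroup for each prime `p` dividing
the order of `G`, any two of which permute. -/
structure SylowSystem (G : Type*) [Group G] where
  /-- The chosen Sylow subgroups. -/
  sylow : ∀ p : (Nat.card G).primeFactors, Sylow (p : ℕ) G
  permute : ∀ p q, (sylow p : Set G) * (sylow q : Set G) = (sylow q : Set G) * (sylow p : Set G)

/-- The (absolute) system normalizer of a Sylow system: all elements that normalize every member
of the system. -/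
def SylowSystem.normalizer {G : Type*} [Group G] (S : SylowSystem G) : Subgroup G :=
  ⨅ p, Subgroup.normalizer (S.sylow p : Set G)

/-! Write N = G', a nontrivial abelian group. For a Sylow system with normalizer M, G is the
semidirect product of N by M, and M is abelian. Indeed M ∩ N = 1: otherwise it has a nontrivial
p-element, centralized both by an abelian Sylow p-subgroup and by the Hall p'-subgroup of the
system, hence central (`famNormalizer_inf_eq_bot`). And NM = G by a Frattini argument
(`exists_mul_mem_famNormalizer`). Both facts are proved for any family of Hall p'-subgroups, so they
also give the complement from which a Sylow system is built.

If no nontrivial element of M centralized a nontrivial element of N, G would be Frobenius; this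
yields x*. Put W = ⟨x*⟩N and take c* ≠ 1 in Z(W). If g commutes with some n ≠ 1 in N, then g, n, c*
is a path. Otherwise g is N-conjugate to an element of M (`exists_conj_eq_mul`), so g commutes with
an N-conjugate of x*, which lies in W and so commutes with c*. Hence d(g, c*) ≤ 2, and the diameter
is at most 4. -/

/-! ### Conjugacy of complements and products of permuting subgroups. -/

namespace Subgroup

variable {G : Type*} [Group G]

/-- A normal `p`-subgroup lies in every subgroup of index prime to `p`. -/
theorem le_of_isPGroup_of_not_dvd_index [Finite G] {p : ℕ} (hp : p.Prime) {A L : Subgroup G}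
    [A.Normal] (hA : IsPGroup p A) (hL : ¬ p ∣ L.index) : A ≤ L := by
  have := Fact.mk hp
  obtain ⟨x, hx⟩ := hA.nonempty_fixed_point_of_prime_not_dvd_card (G ⧸ L) hL
  obtain ⟨g, rfl⟩ := QuotientGroup.mk_surjective x
  intro a ha
  have h : g * a * g⁻¹ ∈ A := Normal.conj_mem ‹_› a ha g
  have h2 : (((g * a * g⁻¹) * g : G) : G ⧸ L) = g := hx ⟨_, h⟩
  rw [QuotientGroup.eq] at h2
  have : a⁻¹ ∈ L := by simpa [mul_assoc] using h2
  simpa using this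

/-- Conjugacy of complements of an abelian normal subgroup, coprime case. -/
theorem exists_conj_mem_of_coprime [Finite G] {A H L : Subgroup G} [A.Normal]
    [IsMulCommutative A] (hcop : (Nat.card A).Coprime (Nat.card H))
    (hAL : ∀ x ∈ A, x ∈ L → x = 1) (hH : ∀ h ∈ H, ∃ a ∈ A, a * h ∈ L) :
    ∃ c ∈ A, ∀ h ∈ H, c * h * c⁻¹ ∈ L := by
  classical
  have := Fintype.ofFinite H
  let _ : CommGroup A := { mul_comm := mul_comm' }
  have hH' : ∀ h : H, ∃ a : A, (a * h : G) ∈ L := fun h ↦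
    let ⟨a, ha, h'⟩ := hH h h.2
    ⟨⟨a, ha⟩, h'⟩
  choose a ha using hH'
  -- Since A ∩ L = 1, `a h` is the only element of A carrying h into L; uniqueness makes `a` a
  -- cocycle.
  have hcoc (h k : H) : a (h * k) = a h * MulAut.conjNormal (h : G) (a k) := by
    rw [← mul_inv_eq_one]
    apply Subtype.ext
    refine hAL _ (Subtype.prop _) ?_
    have := L.mul_mem (ha (h * k)) (L.inv_mem (L.mul_mem (ha h) (ha k)))
    convert this using 1
    simp [mul_assoc]
  -- Averaging: c is the |H|-th root of the product of all cocycle values, and it exhibits `a` as a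
  -- coboundary.
  obtain ⟨c, hc⟩ := (powCoprime hcop).surjective (∏ k, a k)
  rw [powCoprime_apply] at hc
  refine ⟨c, c.2, fun h hh ↦ ?_⟩
  have key : a ⟨h, hh⟩ = c * (MulAut.conjNormal h c)⁻¹ := by
    apply (powCoprime hcop).injective
    have e : ∏ k, a k = ∏ k, a (⟨h, hh⟩ * k) :=
      (Equiv.prod_comp (Equiv.mulLeft (⟨h, hh⟩ : H)) a).symm
    simp only [hcoc, Finset.prod_mul_distrib, Finset.prod_const, ← map_prod] at e
    rw [← hc, Finset.card_univ, ← Nat.card_eq_fintype_card] at e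
    simp only [powCoprime_apply]
    rw [mul_pow, inv_pow, ← map_pow]
    exact eq_mul_inv_of_mul_eq e.symm
  have := ha ⟨h, hh⟩
  rw [key] at this
  simpa [mul_assoc] using this

theorem coe_sup_of_mul_comm {H K : Subgroup G} (h : (H : Set G) * K = (K : Set G) * H) :
    (↑(H ⊔ K) : Set G) = H * K := by
  let S : Subgroup G :=
    { carrier := H * K
      one_mem' := ⟨1, H.one_mem, 1, K.one_mem, one_mul 1⟩
      mul_mem' := fun {a b} ha hb ↦ by
        have : a * b ∈ ((H : Set G) * K) * (H * K) := Set.mul_mem_mul ha hb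
        rwa [mul_assoc, ← mul_assoc (K : Set G), ← h, mul_assoc, coe_mul_coe, ← mul_assoc,
          coe_mul_coe] at this
      inv_mem' := fun {a} ha ↦ by
        have : a⁻¹ ∈ ((H : Set G) * K)⁻¹ := Set.inv_mem_inv.2 ha
        rwa [mul_inv_rev, inv_coe_set, inv_coe_set, ← h] at this }
  apply subset_antisymm
  · have : H ⊔ K ≤ S := sup_le (fun x hx ↦ ⟨x, hx, 1, K.one_mem, mul_one x⟩)
      (fun x hx ↦ ⟨1, H.one_mem, x, hx, one_mul x⟩)
    exact this
  · exact Set.mul_subset_iff.2 fun x hx y hy ↦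
      mul_mem (le_sup_left (a := H) (b := K) hx) (le_sup_right (a := H) (b := K) hy)

theorem card_sup_dvd_of_mul_comm [Finite G] {H K : Subgroup G}
    (h : (H : Set G) * K = (K : Set G) * H) :
    Nat.card ↥(H ⊔ K) ∣ Nat.card H * Nat.card K := by
  -- HK is a union of cosets of K, namely the H-orbit of the trivial coset.
  have h1 : Nat.card ↥(H ⊔ K) = Nat.card K * Nat.card (MulAction.orbit H ((1 : G) : G ⧸ K)) := by
    have h2 := card_mul_eq_card_subgroup_mul_card_quotient K (H : Set G)
    have e : MulAction.orbit H ((1 : G) : G ⧸ K) = QuotientGroup.mk '' (H : Set G) := by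
      ext x
      constructor
      · rintro ⟨y, rfl⟩
        exact ⟨y, y.2, congrArg _ (mul_one (y : G)).symm⟩
      · rintro ⟨y, hy, rfl⟩
        exact ⟨⟨y, hy⟩, congrArg _ (mul_one y)⟩
    rw [← coe_sup_of_mul_comm h, ← e] at h2
    exact h2
  rw [h1, mul_comm, Nat.card_congr (MulAction.orbitEquivQuotientStabilizer H _)]
  exact mul_dvd_mul_right (card_quotient_dvd_card _) _

end Subgroup

/-! ### Families of Hall p'-subgroups and the complement they define. -/

namespace Subgroup

variable {G : Type*} [Group G]

/-- A Sylow `p`-subgroup of `N`, as a subgroup of the ambient group. -/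
noncomputable def primePart (N : Subgroup G) (p : ℕ) : Subgroup G :=
  ((default : Sylow p N) : Subgroup N).map N.subtype

theorem primePart_le (N : Subgroup G) (p : ℕ) : N.primePart p ≤ N :=
  map_subtype_le _

theorem isPGroup_primePart (N : Subgroup G) (p : ℕ) : IsPGroup p (N.primePart p) :=
  (default : Sylow p N).isPGroup'.map _

theorem not_dvd_relIndex_primePart [Finite G] (N : Subgroup G) {p : ℕ} (hp : p.Prime) :
    ¬ p ∣ (N.primePart p).relIndex N := by
  have := Fact.mk hp
  have h := (default : Sylow p N).not_dvd_index
  rwa [primePart, relIndex, subgroupOf, comap_map_eq_self_of_injective N.subtype_injective]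

theorem card_primePart [Finite G] (N : Subgroup G) {p : ℕ} (hp : p.Prime) :
    Nat.card (N.primePart p) = p ^ (Nat.card N).factorization p := by
  have := Fact.mk hp
  rw [primePart, Nat.card_congr (equivMapOfInjective _ _ N.subtype_injective).symm.toEquiv]
  exact (default : Sylow p N).card_eq_multiplicity

theorem exists_mem_primePart [Finite G] (N : Subgroup G) [IsMulCommutative N]
    {K : Subgroup G} (hK : K ⊓ N ≠ ⊥) :
    ∃ p : ℕ, p.Prime ∧ p ∣ Nat.card N ∧ ∃ x ∈ K, x ∈ N.primePart p ∧ x ≠ 1 := by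
  have h1 : Nat.card ↥(K ⊓ N) ≠ 1 := by rwa [Ne, card_eq_one]
  obtain ⟨p, hp, hd⟩ := Nat.exists_prime_and_dvd h1
  have := Fact.mk hp
  obtain ⟨⟨x, hxKN⟩, hx⟩ := exists_prime_orderOf_dvd_card' p hd
  rw [orderOf_mk] at hx
  obtain ⟨hxK, hxN⟩ := mem_inf.1 hxKN
  refine ⟨p, hp, hd.trans (card_dvd_of_le inf_le_right), x, hxK, ?_, ?_⟩
  · have hP : IsPGroup p (zpowers (⟨x, hxN⟩ : N)) :=
      IsPGroup.of_card (n := 1) (by rw [Nat.card_zpowers, orderOf_mk, hx, pow_one])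
    obtain ⟨Q, hQ⟩ := hP.exists_le_sylow
    have := Sylow.unique_of_normal Q
      ⟨fun a ha g ↦ by rwa [mul_comm' g a, mul_inv_cancel_right]⟩
    rw [Subsingleton.elim Q default] at hQ
    exact ⟨_, hQ (mem_zpowers _), rfl⟩
  · rintro rfl
    exact hp.one_lt.ne (by simpa using hx)

theorem normal_primePart [Finite G] (N : Subgroup G) [N.Normal] [IsMulCommutative N]
    {p : ℕ} (hp : p.Prime) : (N.primePart p).Normal := by
  have := Fact.mk hp
  have := Sylow.characteristic_of_normal (default : Sylow p N)
    ⟨fun a ha g ↦ by rwa [mul_comm' g a, mul_inv_cancel_right]⟩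
  unfold primePart
  infer_instance

/-- `H` is a Hall subgroup for the set of primes different from `q`. -/
def IsHallCompl (q : ℕ) (H : Subgroup G) : Prop :=
  ¬ q ∣ Nat.card H ∧ ∀ p : ℕ, p.Prime → p ∣ H.index → p = q

theorem IsHallCompl.conj {q : ℕ} {H : Subgroup G} (h : IsHallCompl q H) (g : G) :
    IsHallCompl q (H.map (MulAut.conj g).toMonoidHom) := by
  have e1 : Nat.card (H.map (MulAut.conj g).toMonoidHom) = Nat.card H :=
    Nat.card_congr (H.equivMapOfInjective _ (MulAut.conj g).injective).symm.toEquiv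
  have e2 : (H.map (MulAut.conj g).toMonoidHom).index = H.index :=
    index_map_equiv H (MulAut.conj g)
  rwa [IsHallCompl, e1, e2]

/-- The elements normalizing every `H q`, for `q` a prime divisor of `|G|`. -/
def famNormalizer (H : ℕ → Subgroup G) : Subgroup G :=
  ⨅ q ∈ (Nat.card G).primeFactors, normalizer (H q : Set G)

theorem mem_famNormalizer {H : ℕ → Subgroup G} {g : G} :
    g ∈ famNormalizer H ↔ ∀ q ∈ (Nat.card G).primeFactors, g ∈ normalizer (H q : Set G) := by
  simp [famNormalizer]

theorem eq_one_of_mem_primePart [Finite G] (N : Subgroup G) {q : ℕ} (hq : q.Prime) {H : Subgroup G}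
    (h : IsHallCompl q H) {x : G} (hx : x ∈ N.primePart q) (hxH : x ∈ H) : x = 1 := by
  have hcop : (Nat.card (N.primePart q)).Coprime (Nat.card H) := by
    rw [N.card_primePart hq]
    exact Nat.Coprime.pow_left _ ((Nat.Prime.coprime_iff_not_dvd hq).2 h.1)
  exact disjoint_def.1 (disjoint_of_coprime_natCard hcop) hx hxH

section

variable [Finite G] (N : Subgroup G) [N.Normal] [IsMulCommutative N]

theorem primePart_le_of_isHallCompl {p q : ℕ} (hp : p.Prime) (hpq : p ≠ q) {H : Subgroup G}
    (h : IsHallCompl q H) : N.primePart p ≤ H := by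
  have := N.normal_primePart hp
  exact le_of_isPGroup_of_not_dvd_index hp (N.isPGroup_primePart p) fun hd ↦ hpq (h.2 p hp hd)

/-- No prime divides the index: the Sylow q-subgroup of N lies in the first factor, the others in H.
-/
theorem le_primePart_sup {q : ℕ} {H : Subgroup G} (h : IsHallCompl q H) :
    N ≤ N.primePart q ⊔ H := by
  rw [← relIndex_eq_one]
  by_contra hne
  obtain ⟨p, hp, hd⟩ := Nat.exists_prime_and_dvd hne
  have hle : N.primePart p ≤ N.primePart q ⊔ H := by
    by_cases hpq : p = q
    · exact hpq ▸ le_sup_left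
    · exact (N.primePart_le_of_isHallCompl hp hpq h).trans le_sup_right
  exact N.not_dvd_relIndex_primePart hp (hd.trans (relIndex_dvd_of_le_left N hle))

/-- A Frattini argument for a Hall subgroup. -/
theorem exists_mul_mem_normalizer (hN : _root_.commutator G ≤ N) {q : ℕ} (hq : q.Prime)
    {H : Subgroup G} (h : IsHallCompl q H) (g : G) :
    ∃ a ∈ N.primePart q, a * g ∈ normalizer (H : Set G) := by
  have := N.normal_primePart hq
  have hcomm : IsMulCommutative (N.primePart q) :=
    .of_comm fun a b ↦ Subtype.ext <| congrArg (Subtype.val (p := (· ∈ N))) <|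
      mul_comm' (⟨a, N.primePart_le q a.2⟩ : N) ⟨b, N.primePart_le q b.2⟩
  have hcop : (Nat.card (N.primePart q)).Coprime
      (Nat.card (H.map (MulAut.conj g).toMonoidHom)) := by
    rw [N.card_primePart hq]
    exact Nat.Coprime.pow_left _ ((Nat.Prime.coprime_iff_not_dvd hq).2 (h.conj g).1)
  -- As gkg⁻¹ = [g,k]k with [g,k] in N, the conjugate of H lies in N_q H, where it can be moved back
  -- to H by an element of N_q.
  obtain ⟨c, hc, hcH⟩ := exists_conj_mem_of_coprime (L := H) hcop
    (fun x hx hxH ↦ N.eq_one_of_mem_primePart hq h hx hxH) (by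
      rintro _ ⟨k, hk, rfl⟩
      have h1 : g * k * g⁻¹ * k⁻¹ ∈ N.primePart q ⊔ H :=
        N.le_primePart_sup h (hN (commutator_mem_commutator (mem_top g) (mem_top k)))
      rw [← SetLike.mem_coe, normal_mul] at h1
      obtain ⟨a, ha, l, hl, e⟩ := h1
      refine ⟨a⁻¹, inv_mem ha, ?_⟩
      have : a⁻¹ * (g * k * g⁻¹) = l * k := by
        simp only at e
        rw [eq_mul_inv_iff_mul_eq] at e
        rw [← e]; group
      simpa [this] using mul_mem hl hk)
  refine ⟨c, hc, ?_⟩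
  rw [mem_normalizer_iff_map_conj_eq]
  refine eq_of_le_of_card_ge ?_ ?_
  · rintro _ ⟨k, hk, rfl⟩
    have := hcH _ ⟨k, hk, rfl⟩
    simpa [mul_assoc] using this
  · exact (Nat.card_congr (H.equivMapOfInjective _ (MulAut.conj (c * g)).injective).toEquiv).le

/-- The corrections for the various q multiply together: those for r ≠ q lie in `H q`, so they do
not disturb its normalization. -/
theorem exists_mul_mem_famNormalizer (hN : _root_.commutator G ≤ N) {H : ℕ → Subgroup G}
    (hH : ∀ q ∈ (Nat.card G).primeFactors, IsHallCompl q (H q)) (g : G) :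
    ∃ a ∈ N, a * g ∈ famNormalizer H := by
  have h1 : ∀ q ∈ (Nat.card G).primeFactors, ∃ a ∈ N.primePart q,
      a * g ∈ normalizer (H q : Set G) := fun q hq ↦
    N.exists_mul_mem_normalizer hN (Nat.prime_of_mem_primeFactors hq) (hH q hq) g
  choose! a ha han using h1
  classical
  let _ : CommGroup N := { mul_comm := mul_comm' }
  let b : ℕ → N := fun q ↦ if h : a q ∈ N then ⟨a q, h⟩ else 1
  have hb : ∀ q ∈ (Nat.card G).primeFactors, (b q : G) = a q := fun q hq ↦ by
    simp [b, N.primePart_le q (ha q hq)]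
  refine ⟨(∏ q ∈ (Nat.card G).primeFactors, b q : N), SetLike.coe_mem _, ?_⟩
  rw [mem_famNormalizer]
  intro q hq
  rw [← Finset.prod_erase_mul _ _ hq, coe_mul, mul_assoc, hb q hq]
  refine mul_mem ?_ (han q hq)
  have : ∏ r ∈ (Nat.card G).primeFactors.erase q, b r ∈ (H q).subgroupOf N := by
    refine prod_mem fun r hr ↦ ?_
    rw [Finset.mem_erase] at hr
    rw [mem_subgroupOf, hb r hr.2]
    exact N.primePart_le_of_isHallCompl (Nat.prime_of_mem_primeFactors hr.2) hr.1 (hH q hq)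
      (ha r hr.2)
  exact le_normalizer (mem_subgroupOf.1 this)

theorem famNormalizer_inf_eq_bot (hA : IsAGroup G) (hcenter : center G = ⊥)
    {H : ℕ → Subgroup G} (hH : ∀ q ∈ (Nat.card G).primeFactors, IsHallCompl q (H q)) :
    famNormalizer H ⊓ N = ⊥ := by
  by_contra hne
  obtain ⟨p, hp, hd, x, hxD, hxp, hx1⟩ := N.exists_mem_primePart hne
  have := Fact.mk hp
  have hpn := N.normal_primePart hp
  have hpG : p ∈ (Nat.card G).primeFactors :=
    Nat.mem_primeFactors.2 ⟨hp, hd.trans (card_subgroup_dvd_card N), Nat.card_pos.ne'⟩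
  obtain ⟨P⟩ : Nonempty (Sylow p G) := inferInstance
  have hNP : N.primePart p ≤ P :=
    le_of_isPGroup_of_not_dvd_index hp (N.isPGroup_primePart p) P.not_dvd_index
  have hPc : (P : Subgroup G) ≤ centralizer {x} := by
    intro y hy
    rw [mem_centralizer_singleton_iff]
    have := hA p hp P
    exact congrArg Subtype.val (mul_comm' (⟨y, hy⟩ : (P : Subgroup G)) ⟨x, hNP hxp⟩)
  -- For y in `H p`, the commutator [x,y] lies in both N_p and `H p`, which meet trivially.
  have hHc : H p ≤ centralizer {x} := by
    intro y hy
    rw [mem_centralizer_singleton_iff, eq_comm, ← mul_inv_eq_one, mul_inv_rev]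
    refine N.eq_one_of_mem_primePart hp (hH p hpG) ?_ ?_
    · have := hpn.conj_mem _ (inv_mem hxp) y
      simpa [mul_assoc] using mul_mem hxp this
    · have := (mem_normalizer_iff.1 (mem_famNormalizer.1 hxD p hpG) y).1 hy
      simpa [mul_assoc] using mul_mem this (inv_mem hy)
  have htop : (centralizer {x} : Subgroup G) = ⊤ := by
    rw [← index_eq_one]
    by_contra hi
    obtain ⟨r, hr, hdr⟩ := Nat.exists_prime_and_dvd hi
    have := (hH p hpG).2 r hr (hdr.trans (index_dvd_of_le hHc))
    subst this
    exact P.not_dvd_index (hdr.trans (index_dvd_of_le hPc))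
  apply hx1
  rw [← mem_bot, ← hcenter, mem_center_iff]
  intro g
  have : g ∈ centralizer {x} := htop ▸ mem_top g
  exact mem_centralizer_singleton_iff.1 this

end

end Subgroup

/-! ### Existence of Hall p'-subgroups and of a Sylow system. -/

namespace Subgroup

variable {G : Type*} [Group G] [Finite G]

/-- In the preimage K of the q'-part of the abelian group G/N, N_q is a normal Sylow q-subgroup;
Schur–Zassenhaus gives it a complement in K. -/
theorem exists_isHallCompl (N : Subgroup G) [N.Normal] [IsMulCommutative N]
    (hN : _root_.commutator G ≤ N) {q : ℕ} (hq : q.Prime) :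
    ∃ H : Subgroup G, IsHallCompl q H := by
  have := Fact.mk hq
  have hNp := N.normal_primePart hq
  have hcomm (a b : G ⧸ N) : a * b = b * a := by
    obtain ⟨x, rfl⟩ := QuotientGroup.mk_surjective a
    obtain ⟨y, rfl⟩ := QuotientGroup.mk_surjective b
    rw [← QuotientGroup.mk_mul, ← QuotientGroup.mk_mul, QuotientGroup.eq]
    have := hN (commutator_mem_commutator (mem_top y⁻¹) (mem_top x⁻¹))
    simpa [commutatorElement_def, mul_assoc] using this
  obtain ⟨Q⟩ : Nonempty (Sylow q (G ⧸ N)) := inferInstance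
  have hQn : (Q : Subgroup (G ⧸ N)).Normal :=
    ⟨fun a ha g ↦ by rwa [hcomm g a, mul_inv_cancel_right]⟩
  obtain ⟨B, hB⟩ := exists_right_complement'_of_coprime Q.card_coprime_index
  let K : Subgroup G := B.comap (QuotientGroup.mk' N)
  have hNK : N ≤ K := fun n hn ↦ by
    have : (n : G ⧸ N) = 1 := (QuotientGroup.eq_one_iff n).2 hn
    simp [K, this]
  have hKi : K.index = Nat.card Q := by
    rw [index_comap_of_surjective _ (QuotientGroup.mk'_surjective N)]
    exact hB.index_eq_card
  have hNKi : N.relIndex K = Nat.card B := by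
    have h1 := relIndex_comap (f := QuotientGroup.mk' N) (H := ⊥) K
    rwa [MonoidHom.comap_bot, QuotientGroup.ker_mk', map_comap_eq_self_of_surjective
      (QuotientGroup.mk'_surjective N), relIndex_bot_left] at h1
  have hrel : ¬ q ∣ (N.primePart q).relIndex K := by
    rw [← relIndex_mul_relIndex _ _ _ (N.primePart_le q) hNK, hNKi, hq.dvd_mul, not_or]
    refine ⟨N.not_dvd_relIndex_primePart hq, ?_⟩
    rw [← hB.symm.index_eq_card]
    exact Q.not_dvd_index
  have hcard : Nat.card ((N.primePart q).subgroupOf K) = Nat.card (N.primePart q) :=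
    Nat.card_congr (subgroupOfEquivOfLe ((N.primePart_le q).trans hNK)).toEquiv
  have hcop : (Nat.card ((N.primePart q).subgroupOf K)).Coprime
      ((N.primePart q).subgroupOf K).index := by
    rw [hcard, N.card_primePart hq]
    exact Nat.Coprime.pow_left _ ((Nat.Prime.coprime_iff_not_dvd hq).2 hrel)
  obtain ⟨H, hH⟩ := exists_right_complement'_of_coprime hcop
  refine ⟨H.map K.subtype, ?_, fun p hp hd ↦ ?_⟩
  · rw [Nat.card_congr (H.equivMapOfInjective _ K.subtype_injective).symm.toEquiv,
      ← hH.symm.index_eq_card]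
    exact hrel
  · rw [index_map_subtype, hH.index_eq_card, hcard, N.card_primePart hq, hKi,
      Q.card_eq_multiplicity, ← pow_add] at hd
    exact (Nat.prime_dvd_prime_iff_eq hp hq).1 (hp.dvd_of_dvd_pow hd)

/-- The products N_p M_p have Sylow order, and permute because the N_p are normal and M is abelian.
-/
theorem nonempty_sylowSystem_of_complement (N M : Subgroup G) [N.Normal] [IsMulCommutative N]
    [IsMulCommutative M] (h : IsComplement' N M) : Nonempty (SylowSystem G) := by
  have hn (p : (Nat.card G).primeFactors) : (N.primePart p).Normal :=
    N.normal_primePart (Nat.prime_of_mem_primeFactors p.2)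
  have hcoe (p : (Nat.card G).primeFactors) :
      ((N.primePart p ⊔ M.primePart p : Subgroup G) : Set G) =
        (N.primePart p : Set G) * (M.primePart p : Set G) := normal_mul _ _
  have hMc (p q : ℕ) : (M.primePart p : Set G) * (M.primePart q : Set G) =
      (M.primePart q : Set G) * (M.primePart p : Set G) := by
    have key (p q : ℕ) : (M.primePart p : Set G) * (M.primePart q : Set G) ⊆
        (M.primePart q : Set G) * (M.primePart p : Set G) := by
      rintro _ ⟨x, hx, y, hy, rfl⟩
      exact ⟨y, hy, x, hx, congrArg Subtype.val
        (mul_comm' (⟨y, M.primePart_le q hy⟩ : M) ⟨x, M.primePart_le p hx⟩)⟩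
    exact (key p q).antisymm (key q p)
  have hcard (p : (Nat.card G).primeFactors) :
      Nat.card ↥(N.primePart p ⊔ M.primePart p) =
        (p : ℕ) ^ (Nat.card G).factorization p := by
    have hp := Nat.prime_of_mem_primeFactors p.2
    have e : (p : ℕ) ^ (Nat.card G).factorization p =
        Nat.card (N.primePart p) * Nat.card (M.primePart p) := by
      have h1 : (Nat.card G).factorization p =
          (Nat.card N).factorization p + (Nat.card M).factorization p := by
        rw [← Finsupp.add_apply, ← Nat.factorization_mul Nat.card_pos.ne' Nat.card_pos.ne',
          h.card_mul_card]
      rw [N.card_primePart hp, M.card_primePart hp, h1, pow_add]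
    rw [e]
    refine le_antisymm (Nat.le_of_dvd (mul_pos Nat.card_pos Nat.card_pos)
      (card_sup_dvd_of_mul_comm (set_mul_normal_comm _ _).symm)) ?_
    rw [← Nat.card_prod]
    have hinj := mul_injective_of_disjoint
      (h.disjoint.mono (N.primePart_le p) (M.primePart_le p))
    exact Nat.card_le_card_of_injective
      (fun x ↦ (⟨x.1 * x.2, mul_mem_sup x.1.2 x.2.2⟩ : ↥(N.primePart p ⊔ M.primePart p)))
      fun x y hxy ↦ hinj (congrArg Subtype.val hxy)
  refine ⟨⟨fun p ↦
    have := Fact.mk (Nat.prime_of_mem_primeFactors p.2)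
    Sylow.ofCard _ (hcard p), fun p q ↦ ?_⟩⟩
  have e (p : (Nat.card G).primeFactors) : ((have := Fact.mk (Nat.prime_of_mem_primeFactors p.2)
    Sylow.ofCard _ (hcard p) : Sylow (p : ℕ) G) : Set G) =
        (N.primePart p : Set G) * (M.primePart p : Set G) := hcoe p
  rw [e, e]
  have key (p q : (Nat.card G).primeFactors) :
      (N.primePart p : Set G) * M.primePart p * (N.primePart q * M.primePart q) =
      (N.primePart p : Set G) * N.primePart q * (M.primePart p * M.primePart q) := by
    rw [mul_assoc, ← mul_assoc (M.primePart p : Set G),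
      set_mul_normal_comm _ (N.primePart q), mul_assoc, mul_assoc]
  rw [key, key, hMc q p, set_mul_normal_comm _ (N.primePart q)]

end Subgroup

/-! ### Passing from a Sylow system to its Hall p'-subgroups. -/

namespace SylowSystem

open Subgroup

variable {G : Type*} [Group G] (S : SylowSystem G)

/-- The join of the members of a Sylow system indexed by `s`. -/
noncomputable def join (s : Finset (Nat.card G).primeFactors) : Subgroup G :=
  s.sup fun p ↦ (S.sylow p : Subgroup G)

theorem join_insert [DecidableEq (Nat.card G).primeFactors] (p : (Nat.card G).primeFactors) (s : Finset (Nat.card G).primeFactors) :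
    S.join (insert p s) = (S.sylow p : Subgroup G) ⊔ S.join s :=
  Finset.sup_insert

theorem join_mul_comm [Finite G] (s : Finset (Nat.card G).primeFactors) (r : (Nat.card G).primeFactors) :
    (S.sylow r : Set G) * S.join s = S.join s * (S.sylow r : Set G) := by
  classical
  induction s using Finset.induction_on generalizing r with
  | empty => simp [join]
  | insert p s _ ih =>
    have e : (S.join (insert p s) : Set G) = (S.sylow p : Set G) * S.join s := by
      rw [join_insert]
      exact coe_sup_of_mul_comm (ih p)
    rw [e, ← mul_assoc, S.permute, mul_assoc, ih, mul_assoc]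

theorem not_dvd_card_join [Finite G] {q : ℕ} (hq : q.Prime) (s : Finset (Nat.card G).primeFactors)
    (hs : ∀ p ∈ s, (p : ℕ) ≠ q) : ¬ q ∣ Nat.card (S.join s) := by
  classical
  induction s using Finset.induction_on with
  | empty => simpa [join] using hq.one_lt.ne'
  | insert p s _ ih =>
    rw [join_insert]
    intro hd
    have hdvd : Nat.card ↥((S.sylow p : Subgroup G) ⊔ S.join s) ∣
        Nat.card (S.sylow p : Subgroup G) * Nat.card (S.join s) :=
      card_sup_dvd_of_mul_comm (S.join_mul_comm s p)
    rcases hq.dvd_mul.1 (hd.trans hdvd) with h | h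
    · have hp := Nat.prime_of_mem_primeFactors p.2
      have := Fact.mk hp
      replace h : q ∣ (p : ℕ) ^ _ := (S.sylow p).card_eq_multiplicity ▸ h
      exact hs p (Finset.mem_insert_self _ _)
        ((Nat.prime_dvd_prime_iff_eq hq hp).1 (hq.dvd_of_dvd_pow h)).symm
    · exact ih (fun r hr ↦ hs r (Finset.mem_insert_of_mem hr)) h

theorem normalizer_le_normalizer_join (s : Finset (Nat.card G).primeFactors) :
    S.normalizer ≤ Subgroup.normalizer (S.join s : Set G) := by
  classical
  intro g hg
  rw [mem_normalizer_iff_map_conj_eq]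
  induction s using Finset.induction_on with
  | empty =>
    exact Subgroup.map_bot _
  | insert p s _ ih =>
    rw [join_insert, Subgroup.map_sup, ih]
    congr 1
    exact mem_normalizer_iff_map_conj_eq.1 (mem_iInf.1 hg p)

/-- The Hall subgroup for the primes different from `q` generated by a Sylow system. -/
noncomputable def hallCompl (q : ℕ) : Subgroup G :=
  S.join (Finset.univ.filter fun p ↦ (p : ℕ) ≠ q)

theorem sylow_le_hallCompl {q : ℕ} {p : (Nat.card G).primeFactors} (h : (p : ℕ) ≠ q) :
    (S.sylow p : Subgroup G) ≤ S.hallCompl q :=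
  Finset.le_sup (f := fun p ↦ (S.sylow p : Subgroup G))
    (Finset.mem_filter.2 ⟨Finset.mem_univ p, h⟩)

theorem isHallCompl_hallCompl [Finite G] {q : ℕ} (hq : q.Prime) : IsHallCompl q (S.hallCompl q) := by
  refine ⟨S.not_dvd_card_join hq _ fun p hp ↦ (Finset.mem_filter.1 hp).2, fun p hp hd ↦ ?_⟩
  by_contra hpq
  have := Fact.mk hp
  have hpG : p ∈ (Nat.card G).primeFactors :=
    Nat.mem_primeFactors.2 ⟨hp, hd.trans (index_dvd_card _), Nat.card_pos.ne'⟩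
  exact (S.sylow ⟨p, hpG⟩).not_dvd_index
    (hd.trans (index_dvd_of_le (S.sylow_le_hallCompl (p := ⟨p, hpG⟩) hpq)))

/-- Each Sylow member is recovered as the intersection of the Hall q'-subgroups over q ≠ p: that
intersection is a p-group containing it. -/
theorem normalizer_eq_famNormalizer [Finite G] : S.normalizer = famNormalizer S.hallCompl := by
  apply le_antisymm
  · intro g hg
    rw [mem_famNormalizer]
    exact fun q _ ↦ S.normalizer_le_normalizer_join _ hg
  · intro g hg
    refine mem_iInf.2 fun p ↦ ?_
    have hp := Nat.prime_of_mem_primeFactors p.2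
    have := Fact.mk hp
    let L : Subgroup G := ⨅ q ∈ (Nat.card G).primeFactors.erase p, S.hallCompl q
    have hL : IsPGroup p L := by
      rw [IsPGroup.iff_card]
      refine ⟨_, Nat.eq_prime_pow_of_unique_prime_dvd Nat.card_pos.ne' fun {q} hq hd ↦ ?_⟩
      by_contra hqp
      have hqG : q ∈ (Nat.card G).primeFactors.erase p := Finset.mem_erase.2
        ⟨hqp, Nat.mem_primeFactors.2 ⟨hq, hd.trans (card_subgroup_dvd_card L), Nat.card_pos.ne'⟩⟩
      exact (S.isHallCompl_hallCompl hq).1 (hd.trans (card_dvd_of_le (iInf₂_le q hqG)))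
    have hSL : (S.sylow p : Subgroup G) ≤ L :=
      le_iInf₂ fun q hq ↦ S.sylow_le_hallCompl (Finset.mem_erase.1 hq).1.symm
    have e : L = S.sylow p := (S.sylow p).is_maximal' hL hSL
    change g ∈ Subgroup.normalizer ((S.sylow p : Subgroup G) : Set G)
    rw [← e, mem_normalizer_iff]
    intro h
    simp only [L, mem_iInf]
    exact forall₂_congr fun q hq ↦
      mem_normalizer_iff.1 (mem_famNormalizer.1 hg q (Finset.mem_of_mem_erase hq)) h

end SylowSystem

/-! ### Distances in the commuting graph and the main theorem. -/

open Subgroup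

section

variable {G : Type*} [Group G]

theorem commutingGraph_edist_le_two (hcenter : center G = ⊥)
    (g c : {g : G // g ∉ center G}) {y : G} (hy : y ≠ 1) (hgy : Commute (g : G) y)
    (hyc : Commute y c) : (commutingGraph G).edist g c ≤ 2 := by
  have key (a b : {g : G // g ∉ center G}) (h : Commute (a : G) b) :
      (commutingGraph G).edist a b ≤ 1 := by
    rw [SimpleGraph.edist_le_one_iff_adj_or_eq]
    by_cases hab : a = b
    · exact Or.inr hab
    · exact Or.inl ⟨hab, h⟩
  let y' : {g : G // g ∉ center G} := ⟨y, by rwa [hcenter, mem_bot]⟩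
  calc (commutingGraph G).edist g c
      ≤ (commutingGraph G).edist g y' + (commutingGraph G).edist y' c :=
        SimpleGraph.edist_triangle
    _ ≤ 1 + 1 := add_le_add (key g y' hgy) (key y' c hyc)
    _ = 2 := one_add_one_eq_two

/-- If `g` centralizes no nontrivial element of the finite abelian normal subgroup `N`, then
every element of `N g` is conjugate to `g` under `N`. -/
theorem exists_conj_eq_mul [Finite G] {N : Subgroup G} [N.Normal] [IsMulCommutative N] {g : G}
    (hg : ∀ n ∈ N, Commute g n → n = 1) {a : G} (ha : a ∈ N) :
    ∃ n ∈ N, n * g * n⁻¹ = a * g := by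
  let f : N → N := fun n ↦ n * (MulAut.conjNormal g n)⁻¹
  have hf : Function.Injective f := by
    intro n k hnk
    have h1 : k⁻¹ * n = MulAut.conjNormal g (k⁻¹ * n) := by
      rw [map_mul, map_inv]
      have : n = k * (MulAut.conjNormal g k)⁻¹ * MulAut.conjNormal g n :=
        mul_inv_eq_iff_eq_mul.1 hnk
      rw [inv_mul_eq_iff_eq_mul, ← mul_assoc]
      exact this
    have h2 : k⁻¹ * n = 1 := by
      apply Subtype.ext
      refine hg _ (SetLike.coe_mem _) ?_
      have h3 := congrArg Subtype.val h1
      rw [MulAut.conjNormal_apply] at h3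
      exact (eq_mul_inv_iff_mul_eq.1 h3).symm
    exact (inv_mul_eq_one.1 h2).symm
  obtain ⟨n, hn⟩ := Finite.surjective_of_injective hf ⟨a, ha⟩
  refine ⟨n, n.2, ?_⟩
  have := congrArg Subtype.val hn
  simp only [f, coe_mul, coe_inv, MulAut.conjNormal_apply] at this
  rw [← this]
  group

theorem isMulCommutative_of_inf_eq_bot {M N : Subgroup G} (hN : commutator G ≤ N)
    (h : M ⊓ N = ⊥) : IsMulCommutative M := by
  refine .of_comm fun x y ↦ Subtype.ext ?_
  have h1 : (x * y * (x : G)⁻¹ * (y : G)⁻¹ : G) ∈ M ⊓ N := mem_inf.2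
    ⟨mul_mem (mul_mem (mul_mem x.2 y.2) (inv_mem x.2)) (inv_mem y.2),
      hN (commutator_mem_commutator (mem_top _) (mem_top _))⟩
  rw [h, mem_bot, mul_inv_eq_one, mul_inv_eq_iff_eq_mul] at h1
  exact h1

theorem isComplement'_of_exists_mul_mem {M N : Subgroup G} [N.Normal] (h : M ⊓ N = ⊥)
    (hMN : ∀ g, ∃ a ∈ N, a * g ∈ M) : IsComplement' N M := by
  refine isComplement'_of_disjoint_and_mul_eq_univ (disjoint_iff.2 (by rwa [inf_comm])) ?_
  refine Set.eq_univ_of_forall fun g ↦ ?_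
  obtain ⟨a, ha, hag⟩ := hMN g
  exact ⟨a⁻¹, inv_mem ha, a * g, hag, inv_mul_cancel_left a g⟩

/-- In a centerless group `N M` with `N` abelian normal and `M` abelian, the central elements of
`⟨x⟩ N`, `x ∈ M`, are within distance two of every vertex of the commuting graph. -/
theorem edist_le_two_of_mem_center [Finite G] {M N : Subgroup G} [N.Normal] [IsMulCommutative N]
    [IsMulCommutative M] (hcenter : center G = ⊥) (hMN : ∀ g, ∃ a ∈ N, a * g ∈ M) {x : G}
    (hx : x ∈ M) (hx1 : x ≠ 1) {c : ↥(zpowers x ⊔ N)} (hc : c ∈ center ↥(zpowers x ⊔ N))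
    (hc' : (c : G) ∉ center G) (g : {g : G // g ∉ center G}) :
    (commutingGraph G).edist g ⟨(c : G), hc'⟩ ≤ 2 := by
  have hcomm {y : G} (hy : y ∈ zpowers x ⊔ N) : Commute y c :=
    congrArg Subtype.val (mem_center_iff.1 hc ⟨y, hy⟩)
  by_cases hg : ∀ n ∈ N, Commute (g : G) n → n = 1
  · obtain ⟨a, ha, hag⟩ := hMN g
    obtain ⟨n, hn, hng⟩ := exists_conj_eq_mul hg ha
    -- Both ngn⁻¹ = ag and x lie in the abelian group M; conjugating back by n, g commutes with
    -- n⁻¹xn.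
    refine commutingGraph_edist_le_two hcenter _ _ (y := n⁻¹ * x * n) ?_ ?_ (hcomm ?_)
    · intro h
      apply hx1
      rw [mul_eq_one_iff_eq_inv, inv_mul_eq_iff_eq_mul, mul_inv_cancel] at h
      exact h
    · have h1 : Commute (a * g : G) x :=
        congrArg Subtype.val (mul_comm' (⟨a * g, hag⟩ : M) ⟨x, hx⟩)
      rw [← hng] at h1
      have := (Commute.conj_iff (n⁻¹)).2 h1
      simpa [mul_assoc] using this
    · have hnW : n ∈ zpowers x ⊔ N := le_sup_right (a := zpowers x) hn
      exact mul_mem (mul_mem (inv_mem hnW) (le_sup_left (b := N) (mem_zpowers x))) hnW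
  · push Not at hg
    obtain ⟨n, hn, hgn, hn1⟩ := hg
    exact commutingGraph_edist_le_two hcenter _ _ hn1 hgn
      (hcomm (le_sup_right (a := zpowers x) hn))

theorem center_zpowers_sup_ne_bot {N : Subgroup G} [IsMulCommutative N] {x : G}
    (h : centralizer {x} ⊓ N ≠ ⊥) : center ↥(zpowers x ⊔ N) ≠ ⊥ := by
  obtain ⟨n, hn, hn1⟩ := (bot_or_exists_ne_one _).resolve_left h
  obtain ⟨hnx, hnN⟩ := mem_inf.1 hn
  have hle : zpowers x ⊔ N ≤ centralizer {n} := by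
    refine sup_le (zpowers_le.2 ?_) fun y hy ↦ ?_
    · exact mem_centralizer_singleton_iff.2 (mem_centralizer_singleton_iff.1 hnx).symm
    · exact mem_centralizer_singleton_iff.2
        (congrArg Subtype.val (mul_comm' (⟨y, hy⟩ : N) ⟨n, hnN⟩))
  intro hbot
  have hnc : (⟨n, le_sup_right (a := zpowers x) hnN⟩ : ↥(zpowers x ⊔ N)) ∈
      center ↥(zpowers x ⊔ N) :=
    mem_center_iff.2 fun w ↦ Subtype.ext (mem_centralizer_singleton_iff.1 (hle w.2))
  rw [hbot, mem_bot] at hnc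
  exact hn1 (congrArg Subtype.val hnc)

theorem isFrobenius_of_complement {M N : Subgroup G} [N.Normal] (hN : N ≠ ⊥) (hM : M ≠ ⊥)
    (h : IsComplement' N M) (hfix : ∀ x ∈ M, x ≠ 1 → centralizer {x} ⊓ N = ⊥) :
    IsFrobenius G := by
  refine ⟨N, ‹_›, hN, M, hM, h, fun x hx hx1 n hn hxn ↦ ?_⟩
  rw [← mem_bot, ← hfix x hx hx1]
  exact ⟨mem_centralizer_singleton_iff.2 (mul_inv_eq_iff_eq_mul.1 hxn).symm, hn⟩

end

theorem lemma3p2 (G : Type*) [Group G] [Finite G] (hsolv : Group.IsSolvable G) (hA : IsAGroup G)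
    (hlen : HasDerivedLength G 2) (hcenter : Subgroup.center G = ⊥)
    (hF : ¬ IsFrobenius G) (hF2 : ¬ IsTwoFrobenius G) :
    (commutingGraph G).Connected ∧ (commutingGraph G).ediam ≤ 4 ∧
    Nonempty (SylowSystem G) ∧
    ∀ S : SylowSystem G,
      (∃ x ∈ S.normalizer, x ≠ 1 ∧ Subgroup.centralizer {x} ⊓ commutator G ≠ ⊥) ∧
      ∀ x ∈ S.normalizer, x ≠ 1 → Subgroup.centralizer {x} ⊓ commutator G ≠ ⊥ →
        Subgroup.center ↥(Subgroup.zpowers x ⊔ commutator G) ≠ ⊥ ∧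
        ∀ c ∈ Subgroup.center ↥(Subgroup.zpowers x ⊔ commutator G), c ≠ 1 →
          ∃ hc : (c : G) ∉ Subgroup.center G,
            ∀ g : {g : G // g ∉ Subgroup.center G},
              (commutingGraph G).edist g ⟨(c : G), hc⟩ ≤ 2 := by
  have hN : commutator G ≠ ⊥ := fun h ↦ by
    have : 2 ≤ 1 := hlen.2 (by simpa using h)
    omega
  have hNc : IsMulCommutative (commutator G) := by
    have h2 : ⁅commutator G, commutator G⁆ = ⊥ := by
      have := hlen.1
      simpa [derivedSeries_succ] using this
    refine .of_comm fun x y ↦ Subtype.ext ?_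
    exact mem_centralizer_iff.1 (commutator_eq_bot_iff_le_centralizer.1 h2 y.2) x x.2
  have hsystem : Nonempty (SylowSystem G) := by
    have hex : ∀ q ∈ (Nat.card G).primeFactors, ∃ H : Subgroup G, IsHallCompl q H := fun q hq ↦
      (commutator G).exists_isHallCompl le_rfl (Nat.prime_of_mem_primeFactors hq)
    choose! H hH using hex
    have hinf := (commutator G).famNormalizer_inf_eq_bot hA hcenter hH
    have := isMulCommutative_of_inf_eq_bot le_rfl hinf
    exact nonempty_sylowSystem_of_complement _ _ (isComplement'_of_exists_mul_mem hinf
      ((commutator G).exists_mul_mem_famNormalizer le_rfl hH))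
  have hS : ∀ S : SylowSystem G,
      (∃ x ∈ S.normalizer, x ≠ 1 ∧ centralizer {x} ⊓ commutator G ≠ ⊥) ∧
      ∀ x ∈ S.normalizer, x ≠ 1 → centralizer {x} ⊓ commutator G ≠ ⊥ →
        center ↥(zpowers x ⊔ commutator G) ≠ ⊥ ∧
        ∀ c ∈ center ↥(zpowers x ⊔ commutator G), c ≠ 1 →
          ∃ hc : (c : G) ∉ center G,
            ∀ g : {g : G // g ∉ center G}, (commutingGraph G).edist g ⟨(c : G), hc⟩ ≤ 2 := by
    intro S
    have hH : ∀ q ∈ (Nat.card G).primeFactors, IsHallCompl q (S.hallCompl q) := fun q hq ↦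
      S.isHallCompl_hallCompl (Nat.prime_of_mem_primeFactors hq)
    have hinf : S.normalizer ⊓ commutator G = ⊥ := by
      rw [S.normalizer_eq_famNormalizer]
      exact (commutator G).famNormalizer_inf_eq_bot hA hcenter hH
    have hMN : ∀ g, ∃ a ∈ commutator G, a * g ∈ S.normalizer := by
      rw [S.normalizer_eq_famNormalizer]
      exact (commutator G).exists_mul_mem_famNormalizer le_rfl hH
    have hcompl := isComplement'_of_exists_mul_mem hinf hMN
    have hMc := isMulCommutative_of_inf_eq_bot le_rfl hinf
    -- If M = 1 then G = N is abelian, so N is central and therefore trivial.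
    have hM : S.normalizer ≠ ⊥ := by
      intro h
      apply hN
      rw [h, isComplement'_bot_right] at hcompl
      rw [eq_bot_iff, ← hcenter]
      intro n hn
      exact mem_center_iff.2 fun g ↦ congrArg Subtype.val
        (mul_comm' (⟨g, hcompl ▸ mem_top g⟩ : commutator G) ⟨n, hn⟩)
    constructor
    · by_contra! h
      exact hF (isFrobenius_of_complement hN hM hcompl h)
    · refine fun x hx hx1 hxN ↦ ⟨center_zpowers_sup_ne_bot hxN, fun c hc hc1 ↦
        ⟨?_, edist_le_two_of_mem_center hcenter hMN hx hx1 hc _⟩⟩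
      rw [hcenter, mem_bot]
      exact fun h ↦ hc1 (Subtype.ext h)
  obtain ⟨S⟩ := id hsystem
  obtain ⟨x, hx, hx1, hxN⟩ := (hS S).1
  obtain ⟨hZ, hdist⟩ := (hS S).2 x hx hx1 hxN
  obtain ⟨c, hcZ, hc1⟩ := (bot_or_exists_ne_one _).resolve_left hZ
  obtain ⟨hc, hdist⟩ := hdist c hcZ hc1
  have hdiam : ∀ u v, (commutingGraph G).edist u v ≤ 4 := fun u v ↦
    calc (commutingGraph G).edist u v
        ≤ (commutingGraph G).edist u ⟨c, hc⟩ + (commutingGraph G).edist ⟨c, hc⟩ v :=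
          SimpleGraph.edist_triangle
      _ ≤ 2 + 2 := add_le_add (hdist u) (SimpleGraph.edist_comm.trans_le (hdist v))
      _ = 4 := by norm_num
  have : Nonempty {g : G // g ∉ center G} := ⟨⟨c, hc⟩⟩
  refine ⟨⟨fun u v ↦ ?_⟩, SimpleGraph.ediam_le_of_edist_le hdiam, hsystem, hS⟩
  exact SimpleGraph.reachable_of_edist_ne_top
    ((hdiam u v).trans_lt (ENat.natCast_lt_top 4)).ne
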